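/- Let $\mathbb D=\{z\in\mathbb C:|z|<1\}$. Let $\mathcal G$ denote the class of functions $h$ analytic in $\mathbb D$, with $h(0)=0$, $h'(0)=1$ and $h'(z)\neq 0$ for $z\in\mathbb D$, such that $$\operatorname{Re}\left(1+\frac{zh''(z)}{h'(z)}\right)<\frac32\qquad\text{for all } z\in\mathbb D .$$ A set $\Omega\subseteq\mathbb C$ is called close-to-convex if $\mathbb C\setminus\Omega$ is the union of closed half-lines whose interiors (the half-lines without their initial points) are pairwise disjoint. A harmonic function $f:\mathbb D\to\mathbb C$ is called close-to-convex if it is sense-preserving (its Jacobian is positive on $\mathbb D$), univalent (injective on $\mathbb D$), and its range $f(\mathbb D)$ is close-to-convex. Let $h\in\mathcal G$, let $n\ge 1$ be an integer, let $\lambda\in\mathbb C$ satisfy $0<|\lambda|\le \frac1{n+1}$, and let $g$ be analytic in $\mathbb D$ with $g'(z)=\lambda z^n h'(z)$ for all $z\in\mathbb D$. Then the harmonic mapping $f=h+\overline g$ is close-to-convex and univalent in $\mathbb D$. -/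

import Mathlib

open scoped ComplexConjugate

/-- The closed half-line with initial point `p` and direction `u`. -/
def closedHalfLine (p u : ℂ) : Set ℂ := {w | ∃ t : ℝ, 0 ≤ t ∧ w = p + t * u}

/-- The interior of that half-line: the half-line without its initial point. -/
def openHalfLine (p u : ℂ) : Set ℂ := {w | ∃ t : ℝ, 0 < t ∧ w = p + t * u}

/-- The complement of `Ω` in the plane is the union of closed half-lines with pairwise disjoint
interiors. Directions are unit vectors, so that a pair `(p, u)` is the same thing as a half-line. -/
def IsCloseToConvexSet (Ω : Set ℂ) : Prop :=
  ∃ R : Set (ℂ × ℂ),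
    (∀ r ∈ R, ‖r.2‖ = 1) ∧
    Ωᶜ = ⋃ r ∈ R, closedHalfLine r.1 r.2 ∧
    R.PairwiseDisjoint (fun r => openHalfLine r.1 r.2)

/-- The normalized analytic functions on the unit disk. -/
structure IsClassA (h : ℂ → ℂ) : Prop where
  analytic : AnalyticOnNhd ℂ h (Metric.ball 0 1)
  map_zero : h 0 = 0
  deriv_zero : deriv h 0 = 1

/-- The class `𝒢`: normalized analytic functions with `Re (1 + z h''(z) / h'(z)) < 3 / 2` on the
unit disk. The requirement `h' ≠ 0` says that the quotient is defined. -/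
structure IsClassG (h : ℂ → ℂ) : Prop extends IsClassA h where
  deriv_ne_zero : ∀ z ∈ Metric.ball (0 : ℂ) 1, deriv h z ≠ 0
  re_lt : ∀ z ∈ Metric.ball (0 : ℂ) 1, (1 + z * deriv (deriv h) z / deriv h z).re < 3 / 2

/-- A sense-preserving harmonic mapping of the unit disk: harmonic with positive Jacobian. -/
structure IsSensePreservingHarmonic (f : ℂ → ℂ) : Prop where
  harmonic : InnerProductSpace.HarmonicOnNhd f (Metric.ball 0 1)
  jacobian_pos : ∀ z ∈ Metric.ball (0 : ℂ) 1, 0 < (fderiv ℝ f z).det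

/-- Univalence on the unit disk. -/
def IsUnivalent (f : ℂ → ℂ) : Prop := Set.InjOn f (Metric.ball 0 1)

/-- A close-to-convex harmonic mapping of the unit disk: a sense-preserving univalent harmonic
function with close-to-convex range. -/
structure IsCloseToConvexHarmonic (f : ℂ → ℂ) : Prop extends IsSensePreservingHarmonic f where
  univalent : IsUnivalent f
  range : IsCloseToConvexSet (f '' Metric.ball 0 1)

/-! The proof compares `f` with an explicit convex harmonic map `κ` of opposite dilatation. Writing
`ω = c * z ^ n`, take `κ` with analytic part `z` and dilatation `-ω`. In the real inner product of
`df v` with `dκ v` the mixed terms cancel, leaving `Re h' * (1 - |ω|²) * |v|²`. Jack's lemma gives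
`|1 - h'| < 1` on the class `𝒢`, so this is positive.

The bound `|c| ≤ 1 / (n + 1)` makes `κ` a homeomorphism of the closed disk onto a convex set `K`.
Integrating the pairing along chords of `K` shows that `f ∘ κ⁻¹` is strictly monotone, hence
injective. Here `f` is Lipschitz, so it has boundary values.

For the range, attach to each boundary value `f(z)` the rays in the outward normal directions of `K`
at `κ(z)`. Monotonicity keeps these rays off the range and their interiors disjoint. They cover the
complement because, for every `y`, the variational inequality of `f ∘ κ⁻¹ - y` on `K` has a
solution, and this puts `y` either in the range or on a normal ray. -/

/-! ### Monotone variational inequalities -/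

section VariationalInequality

variable {E : Type*} [NormedAddCommGroup E] [InnerProductSpace ℝ E] {K : Set E} {P : E → E} {L : ℝ}

/-- Solutions are the fixed points of `x ↦ p (x - τ • P x)`, with `p` the nearest-point projection
onto `K`. Since `p` is nonexpansive, a small step `τ` makes this map a contraction. -/
theorem exists_variational_inequality_of_strongly_monotone (ne : K.Nonempty) (hc : IsComplete K)
    (hK : Convex ℝ K) {μ : ℝ} (hL : 0 < L) (hμ : 0 < μ)
    (hlip : ∀ x ∈ K, ∀ y ∈ K, ‖P x - P y‖ ≤ L * ‖x - y‖)
    (hmono : ∀ x ∈ K, ∀ y ∈ K, μ * ‖x - y‖ ^ 2 ≤ inner ℝ (P x - P y) (x - y)) :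
    ∃ x ∈ K, ∀ w ∈ K, 0 ≤ inner ℝ (P x) (w - x) := by
  have hproj : ∀ u : E, ∃ v ∈ K, ∀ w ∈ K, inner ℝ (u - v) (w - v) ≤ 0 := fun u => by
    obtain ⟨v, hv, h⟩ := exists_norm_eq_iInf_of_complete_convex ne hc hK u
    exact ⟨v, hv, (norm_eq_iInf_iff_real_inner_le_zero hK hv).1 h⟩
  choose p hpK hp using hproj
  have hnonexp : ∀ u v, ‖p u - p v‖ ≤ ‖u - v‖ := fun u v => by
    have h1 := hp u (p v) (hpK v)
    have h2 := hp v (p u) (hpK u)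
    have h3 : ‖p u - p v‖ ^ 2 ≤ inner ℝ (u - v) (p u - p v) := by
      have e : inner ℝ (u - v) (p u - p v) - ‖p u - p v‖ ^ 2 =
          -inner ℝ (u - p u) (p v - p u) - inner ℝ (v - p v) (p u - p v) := by
        rw [← real_inner_self_eq_norm_sq]
        simp only [inner_sub_left, inner_sub_right]
        ring
      linarith
    have h4 := real_inner_le_norm (u - v) (p u - p v)
    rcases (norm_nonneg (p u - p v)).eq_or_lt with h | h
    · rw [← h]; exact norm_nonneg _
    · nlinarith
  -- This `τ` minimizes the squared contraction factor `1 - 2 * τ * μ + τ ^ 2 * L ^ 2`, with minimum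
  -- `1 - μ ^ 2 / L ^ 2`.
  set τ := μ / L ^ 2 with hτ
  have hτ0 : 0 < τ := by positivity
  set q := Real.sqrt (1 - μ ^ 2 / L ^ 2) with hq
  have hq1 : q < 1 := by
    rw [hq, Real.sqrt_lt' one_pos]
    have : 0 < μ ^ 2 / L ^ 2 := by positivity
    linarith
  let T : E → E := fun x => p (x - τ • P x)
  have hT : ∀ x ∈ K, ∀ y ∈ K, ‖T x - T y‖ ≤ q * ‖x - y‖ := fun x hx y hy => by
    refine (hnonexp _ _).trans ?_
    have e : x - τ • P x - (y - τ • P y) = (x - y) - τ • (P x - P y) := by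
      rw [smul_sub]; abel
    rw [e]
    have h1 : ‖(x - y) - τ • (P x - P y)‖ ^ 2 ≤ (1 - μ ^ 2 / L ^ 2) * ‖x - y‖ ^ 2 := by
      rw [norm_sub_sq_real, inner_smul_right, norm_smul, real_inner_comm, Real.norm_eq_abs,
        abs_of_pos hτ0]
      have h2 := mul_le_mul_of_nonneg_left (hmono x hx y hy) hτ0.le
      have h3 : (τ * ‖P x - P y‖) ^ 2 ≤ (τ * (L * ‖x - y‖)) ^ 2 := by
        have := hlip x hx y hy
        gcongr
      have e1 : (τ * (L * ‖x - y‖)) ^ 2 = μ ^ 2 / L ^ 2 * ‖x - y‖ ^ 2 := by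
        rw [hτ]; field_simp
      have e2 : τ * (μ * ‖x - y‖ ^ 2) = μ ^ 2 / L ^ 2 * ‖x - y‖ ^ 2 := by
        rw [hτ]; field_simp
      linarith
    have h2 := Real.sqrt_le_sqrt h1
    rw [Real.sqrt_sq (norm_nonneg _), Real.sqrt_mul' _ (sq_nonneg _),
      Real.sqrt_sq (norm_nonneg _)] at h2
    exact h2
  have hTK : Set.MapsTo T K K := fun x _ => hpK _
  have hcontr : ContractingWith ⟨q, Real.sqrt_nonneg _⟩ (hTK.restrict T K K) := by
    refine ⟨hq1, LipschitzWith.of_dist_le_mul fun x y => ?_⟩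
    rw [Subtype.dist_eq, Subtype.dist_eq, dist_eq_norm, dist_eq_norm]
    exact hT x x.2 y y.2
  obtain ⟨x₀, hx₀⟩ := ne
  obtain ⟨x, hx, hfix, -⟩ := hcontr.exists_fixedPoint' hc hTK hx₀ (edist_ne_top _ _)
  refine ⟨x, hx, fun w hw => ?_⟩
  have h := hp (x - τ • P x) w hw
  have hfix' : p (x - τ • P x) = x := hfix
  rw [hfix', show x - τ • P x - x = -(τ • P x) by abel, inner_neg_left, real_inner_smul_left] at h
  have h' : 0 ≤ τ * inner ℝ (P x) (w - x) := by linarith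
  exact nonneg_of_mul_nonneg_right h' hτ0

/-- Solvability of the variational inequality of a monotone Lipschitz map on a compact convex set. -/
theorem exists_variational_inequality_of_monotone (ne : K.Nonempty) (hc : IsCompact K)
    (hK : Convex ℝ K) (hlip : ∀ x ∈ K, ∀ y ∈ K, ‖P x - P y‖ ≤ L * ‖x - y‖)
    (hmono : ∀ x ∈ K, ∀ y ∈ K, 0 ≤ inner ℝ (P x - P y) (x - y)) :
    ∃ x ∈ K, ∀ w ∈ K, 0 ≤ inner ℝ (P x) (w - x) := by
  -- Adding `ε k • x` makes `P` strongly monotone; by compactness the solutions have a limit point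
  -- as `ε k → 0`.
  let ε : ℕ → ℝ := fun k => 1 / ((k : ℝ) + 1)
  have hε : ∀ k, 0 < ε k := fun k => by positivity
  have hsol : ∀ k, ∃ x ∈ K, ∀ w ∈ K, 0 ≤ inner ℝ (P x + ε k • x) (w - x) := fun k => by
    refine exists_variational_inequality_of_strongly_monotone (P := fun x => P x + ε k • x)
      (L := |L| + ε k) ne hc.isComplete hK (add_pos_of_nonneg_of_pos (abs_nonneg _) (hε k)) (hε k)
      (fun x hx y hy => ?_) fun x hx y hy => ?_
    · rw [show P x + ε k • x - (P y + ε k • y) = (P x - P y) + ε k • (x - y) by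
        rw [smul_sub]; abel]
      refine (norm_add_le _ _).trans ?_
      rw [norm_smul, Real.norm_eq_abs, abs_of_pos (hε k), add_mul]
      gcongr
      exact (hlip x hx y hy).trans (by gcongr; exact le_abs_self L)
    · rw [show P x + ε k • x - (P y + ε k • y) = (P x - P y) + ε k • (x - y) by
        rw [smul_sub]; abel, inner_add_left, real_inner_smul_left, real_inner_self_eq_norm_sq]
      linarith [hmono x hx y hy]
  choose u huK hu using hsol
  obtain ⟨x, hx, φ, hφ, hlim⟩ := hc.tendsto_subseq huK
  refine ⟨x, hx, fun w hw => ?_⟩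
  have hP : Filter.Tendsto (fun k => P (u (φ k))) Filter.atTop (nhds (P x)) := by
    rw [tendsto_iff_norm_sub_tendsto_zero]
    have h0 : Filter.Tendsto (fun k => L * ‖u (φ k) - x‖) Filter.atTop (nhds 0) := by
      have := (tendsto_iff_norm_sub_tendsto_zero.1 hlim).const_mul L
      simpa using this
    exact squeeze_zero (fun _ => norm_nonneg _) (fun k => hlip _ (huK _) _ hx) h0
  have hε0 : Filter.Tendsto (fun k => ε (φ k)) Filter.atTop (nhds 0) :=
    tendsto_one_div_add_atTop_nhds_zero_nat.comp hφ.tendsto_atTop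
  have h := (hP.add (hε0.smul hlim)).inner (𝕜 := ℝ) (hlim.const_sub w)
  rw [zero_smul, add_zero] at h
  exact ge_of_tendsto' h fun k => hu (φ k) w hw

end VariationalInequality

/-! ### Jack's lemma and the derivative of a function in `𝒢` -/

/-- Jack's lemma. -/
theorem exists_mul_deriv_eq_of_norm_le {w : ℂ → ℂ} {z₀ : ℂ} (hz₀ : z₀ ≠ 0)
    (hw : DifferentiableOn ℂ w (Metric.ball 0 ‖z₀‖)) (hd : DifferentiableAt ℂ w z₀)
    (h0 : w 0 = 0) (hmaps : ∀ z, ‖z‖ < ‖z₀‖ → ‖w z‖ < 1) (hsphere : ∀ z, ‖z‖ = ‖z₀‖ → ‖w z‖ ≤ 1)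
    (hone : ‖w z₀‖ = 1) :
    ∃ k : ℝ, 1 ≤ k ∧ z₀ * deriv w z₀ = k * w z₀ := by
  set A := z₀ * deriv w z₀ * conj (w z₀) with hA
  have hr : 0 < ‖z₀‖ := norm_pos_iff.2 hz₀
  -- Schwarz's lemma on the disk of radius `‖z₀‖`; it forces the radial derivative of `‖w‖ ^ 2` at
  -- `z₀` to be at least `2`.
  have hradial : ∀ t : ℝ, 0 ≤ t → t < 1 → ‖w (t * z₀)‖ ≤ t := fun t ht ht1 => by
    have hmem : (t : ℂ) * z₀ ∈ Metric.ball (0 : ℂ) ‖z₀‖ := by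
      rw [mem_ball_zero_iff, norm_mul, Complex.norm_real, Real.norm_eq_abs, abs_of_nonneg ht]
      nlinarith
    have := Complex.dist_le_div_mul_dist_of_mapsTo_ball (R₂ := 1) hw (fun z hz => by
      rw [h0, Metric.mem_closedBall, dist_zero_right]
      exact (hmaps z (mem_ball_zero_iff.1 hz)).le) hmem
    rw [h0, dist_zero_right, dist_zero_right, norm_mul, Complex.norm_real, Real.norm_eq_abs,
      abs_of_nonneg ht] at this
    calc _ ≤ _ := this
      _ = t := by field_simp
  have hcurve : ∀ (γ : ℝ → ℂ) (γ' : ℂ) (s : ℝ), γ s = z₀ → HasDerivAt γ γ' s →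
      HasDerivAt (fun t => ‖w (γ t)‖ ^ 2) (2 * (deriv w z₀ * γ' * conj (w z₀)).re) s := by
    intro γ γ' s hs hγ
    have h1 : HasDerivAt (fun t => w (γ t)) (deriv w z₀ * γ') s := by
      have := hd.hasDerivAt
      rw [← hs] at this ⊢
      exact this.comp s hγ
    have h2 := h1.norm_sq
    convert! h2 using 1
    rw [hs, Complex.inner]
  have hre : 1 ≤ A.re := by
    have h1 : HasDerivAt (fun t : ℝ => ‖w (t * z₀)‖ ^ 2)
        (2 * (deriv w z₀ * z₀ * conj (w z₀)).re) 1 := by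
      refine hcurve (fun t : ℝ => t * z₀) z₀ 1 (by simp) ?_
      simpa using (Complex.ofRealCLM.hasDerivAt (x := (1 : ℝ))).mul_const z₀
    have h2 : HasDerivAt (fun t : ℝ => t ^ 2 - ‖w (t * z₀)‖ ^ 2)
        (2 - 2 * (deriv w z₀ * z₀ * conj (w z₀)).re) 1 := by
      convert! (hasDerivAt_pow 2 (1 : ℝ)).sub h1 using 1
      norm_num
    have h3 := h2.tendsto_slope.mono_left (nhdsWithin_mono (1 : ℝ)
      (show Set.Iio 1 ⊆ {1}ᶜ from fun t ht => ne_of_lt ht))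
    have h4 := le_of_tendsto h3 (b := 0) (by
      filter_upwards [Ioo_mem_nhdsLT (zero_lt_one' ℝ)] with t ht
      rw [slope_def_field]
      refine div_nonpos_of_nonneg_of_nonpos ?_ (by linarith [ht.2])
      have h5 : ‖w (t * z₀)‖ ^ 2 ≤ t ^ 2 := by
        gcongr
        exact hradial t ht.1.le ht.2
      simp only [Complex.ofReal_one, one_mul, hone]
      linarith)
    rw [mul_comm (deriv w z₀)] at h4
    linarith
  -- On the circle through `z₀`, `‖w‖` is maximal at `z₀`, so its tangential derivative vanishes.
  have him : A.im = 0 := by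
    have h1 : HasDerivAt (fun t : ℝ => ‖w (z₀ * Complex.exp (t * Complex.I))‖ ^ 2)
        (2 * (deriv w z₀ * (z₀ * Complex.I) * conj (w z₀)).re) 0 := by
      refine hcurve (fun t : ℝ => z₀ * Complex.exp (t * Complex.I)) (z₀ * Complex.I) 0
        (by simp) ?_
      have := (((Complex.ofRealCLM.hasDerivAt (x := (0 : ℝ))).mul_const Complex.I).cexp).const_mul z₀
      simpa using this
    have hmax : IsLocalMax (fun t : ℝ => ‖w (z₀ * Complex.exp (t * Complex.I))‖ ^ 2) 0 := by
      refine Filter.Eventually.of_forall fun t => ?_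
      have := hsphere (z₀ * Complex.exp (t * Complex.I)) (by
        rw [norm_mul, Complex.norm_exp_ofReal_mul_I, mul_one])
      simp only [Complex.ofReal_zero, zero_mul, Complex.exp_zero, mul_one, hone]
      gcongr
    have h2 := hmax.hasDerivAt_eq_zero h1
    have h3 : deriv w z₀ * (z₀ * Complex.I) * conj (w z₀) = A * Complex.I := by rw [hA]; ring
    rw [h3, Complex.mul_I_re] at h2
    linarith
  refine ⟨A.re, hre, ?_⟩
  have h1 : A = A.re := Complex.ext rfl (by simpa using him)
  rw [← h1, hA, mul_assoc _ (conj _), mul_comm (conj _), Complex.mul_conj, Complex.normSq_eq_norm_sq,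
    hone]
  simp

/-- Otherwise Jack's lemma applies to `w = 1 - h'` at a point `z₀` of least modulus with `|w| ≥ 1`.
There `z₀ h'' / h' = -k w / (1 - w)` has real part `k / 2 ≥ 1 / 2`, since `|w| = 1`, against the
bound `3 / 2`. -/
theorem IsClassG.norm_deriv_sub_one_lt {h : ℂ → ℂ} (hh : IsClassG h) {z : ℂ} (hz : ‖z‖ < 1) :
    ‖1 - deriv h z‖ < 1 := by
  by_contra hcon
  set w : ℂ → ℂ := fun z => 1 - deriv h z with hw
  have hdd : ∀ x, ‖x‖ < 1 → DifferentiableAt ℂ (deriv h) x := fun x hx =>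
    (hh.analytic.deriv x (mem_ball_zero_iff.2 hx)).differentiableAt
  have hwd : ∀ x, ‖x‖ < 1 → DifferentiableAt ℂ w x := fun x hx => (hdd x hx).const_sub 1
  have hsub : ∀ x ∈ Metric.closedBall (0 : ℂ) ‖z‖, ‖x‖ < 1 := fun x hx =>
    (mem_closedBall_zero_iff.1 hx).trans_lt hz
  have hcomp : IsCompact (Metric.closedBall (0 : ℂ) ‖z‖ ∩ (fun x => ‖w x‖) ⁻¹' Set.Ici 1) := by
    refine (isCompact_closedBall (0 : ℂ) ‖z‖).of_isClosed_subset ?_ Set.inter_subset_left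
    exact ContinuousOn.preimage_isClosed_of_isClosed
      (fun x hx => (hwd x (hsub x hx)).continuousAt.norm.continuousWithinAt)
      Metric.isClosed_closedBall isClosed_Ici
  obtain ⟨z₀, ⟨hz₀, hz₀w⟩, hmin⟩ := hcomp.exists_isMinOn
    ⟨z, mem_closedBall_zero_iff.2 le_rfl, not_lt.1 hcon⟩ continuous_norm.continuousOn
  have hz₀1 := hsub z₀ hz₀
  have hw0 : w 0 = 0 := by simp [hw, hh.deriv_zero]
  have hz₀w' : 1 ≤ ‖w z₀‖ := hz₀w
  have hne : z₀ ≠ 0 := fun h => by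
    rw [h, hw0, norm_zero] at hz₀w'
    linarith
  have hlt : ∀ x, ‖x‖ < ‖z₀‖ → ‖w x‖ < 1 := fun x hx => by
    by_contra hx1
    exact absurd (hmin ⟨mem_closedBall_zero_iff.2
      (hx.le.trans (mem_closedBall_zero_iff.1 hz₀)), not_lt.1 hx1⟩) (not_le.2 hx)
  have hle : ∀ x, ‖x‖ = ‖z₀‖ → ‖w x‖ ≤ 1 := fun x hx => by
    have hx1 : ‖x‖ < 1 := hx ▸ hz₀1
    have h1 : Filter.Tendsto (fun t : ℝ => ‖w (t * x)‖) (nhdsWithin 1 (Set.Iio 1)) (nhds ‖w x‖) := by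
      have hc : ContinuousAt (fun t : ℝ => (t : ℂ) * x) 1 := by fun_prop
      have : ContinuousAt (fun t : ℝ => ‖w (t * x)‖) 1 := by
        refine ContinuousAt.norm (ContinuousAt.comp (g := w) ?_ hc)
        simpa using (hwd x hx1).continuousAt
      have h2 := this.tendsto.mono_left (nhdsWithin_le_nhds (s := Set.Iio 1))
      simpa using h2
    refine le_of_tendsto h1 ?_
    filter_upwards [Ioo_mem_nhdsLT (zero_lt_one' ℝ)] with t ht
    refine (hlt _ ?_).le
    rw [norm_mul, Complex.norm_real, Real.norm_eq_abs, abs_of_pos ht.1, hx]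
    have := norm_pos_iff.2 hne
    nlinarith [ht.2]
  have hone : ‖w z₀‖ = 1 := le_antisymm (hle z₀ rfl) hz₀w'
  obtain ⟨k, hk, hkw⟩ := exists_mul_deriv_eq_of_norm_le hne
    (fun x hx => (hwd x ((mem_ball_zero_iff.1 hx).trans hz₀1)).differentiableWithinAt)
    (hwd z₀ hz₀1) hw0 hlt hle hone
  have hdw : deriv w z₀ = -deriv (deriv h) z₀ := by
    rw [hw]; exact ((hdd z₀ hz₀1).hasDerivAt.const_sub 1).deriv
  have hdz := hh.deriv_ne_zero z₀ (mem_ball_zero_iff.2 hz₀1)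
  have hre := hh.re_lt z₀ (mem_ball_zero_iff.2 hz₀1)
  have hd1 : deriv h z₀ = 1 - w z₀ := by simp [hw]
  have hnum : z₀ * deriv (deriv h) z₀ = -(k * w z₀) := by
    rw [← hkw, hdw]; ring
  rw [hnum, hd1, Complex.add_re, Complex.one_re] at hre
  rw [hd1] at hdz
  have hnsq : (w z₀).re ^ 2 + (w z₀).im ^ 2 = 1 := by
    have := Complex.sq_norm (w z₀)
    rw [hone, Complex.normSq_apply] at this
    nlinarith
  have hq : (-(k * w z₀) / (1 - w z₀)).re = k / 2 := by
    have hns : Complex.normSq (1 - w z₀) ≠ 0 := fun h => hdz (Complex.normSq_eq_zero.1 h)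
    have e : Complex.normSq (1 - w z₀) = 2 - 2 * (w z₀).re := by
      rw [Complex.normSq_apply]; simp; nlinarith
    rw [e] at hns
    rw [Complex.div_re, e]
    simp only [Complex.neg_re, Complex.re_ofReal_mul, Complex.neg_im, Complex.im_ofReal_mul,
      Complex.sub_re, Complex.sub_im, Complex.one_re, Complex.one_im]
    rw [← add_div, div_eq_div_iff hns two_ne_zero]
    linear_combination 2 * k * hnsq
  rw [hq] at hre
  linarith

/-! ### The convex comparison map -/

theorem Complex.norm_pow_sub_pow_le_mul {z w : ℂ} (hz : ‖z‖ ≤ 1) (hw : ‖w‖ ≤ 1) (m : ℕ) :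
    ‖z ^ m - w ^ m‖ ≤ m * ‖z - w‖ := by
  induction m with
  | zero => simp
  | succ m ih =>
    have e : z ^ (m + 1) - w ^ (m + 1) = z * (z ^ m - w ^ m) + (z - w) * w ^ m := by ring
    rw [e]
    refine (norm_add_le _ _).trans ?_
    rw [norm_mul, norm_mul, norm_pow]
    have h1 : ‖z‖ * ‖z ^ m - w ^ m‖ ≤ 1 * (m * ‖z - w‖) := by gcongr
    have h2 : ‖z - w‖ * ‖w‖ ^ m ≤ ‖z - w‖ * 1 := by
      gcongr
      exact pow_le_one₀ (norm_nonneg _) hw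
    push_cast
    linarith

/-- The harmonic polynomial `z - b * conj z ^ m`. -/
noncomputable def harmonicHypocycloid (b : ℂ) (m : ℕ) (z : ℂ) : ℂ := z - b * conj z ^ m

namespace harmonicHypocycloid

theorem norm_sum_one_sub_pow_sub_le {ζ : ℂ} (hζ : ‖ζ‖ ≤ 1) {m : ℕ} (hm : 2 ≤ m) :
    ‖∑ k ∈ Finset.range m, (1 - ζ ^ k) - (1 - ζ)‖ ≤ ((m : ℝ) * (m - 1) / 2 - 1) * ‖1 - ζ‖ := by
  induction m, hm using Nat.le_induction with
  | base =>
    have e : ∑ k ∈ Finset.range 2, (1 - ζ ^ k) - (1 - ζ) = 0 := by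
      simp only [Finset.sum_range_succ, Finset.sum_range_zero]
      ring
    rw [e]
    norm_num
  | succ m hm ih =>
    rw [Finset.sum_range_succ, add_sub_right_comm]
    refine (norm_add_le _ _).trans ?_
    have h := Complex.norm_pow_sub_pow_le_mul (z := 1) (by simp) hζ m
    rw [one_pow] at h
    push_cast
    linarith

/-- With `x = 1 - ζ`, everything is measured by `d = Re x`, as `|x|² ≤ 2d` in the disk. In the
expansion of `1 - ζ ^ m` the term `x ^ 2` is kept apart because `Re (x ^ 2) = 2d² - |x|²` exactly.
The surplus `2d²` gives strictness even when `‖β‖ * m ^ 2 = 1`. -/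
theorem supporting_line_at_one {ζ β : ℂ} {m : ℕ} (hm : 2 ≤ m) (hβ : ‖β‖ * m ^ 2 ≤ 1)
    (hζ : ‖ζ‖ ≤ 1) (hne : ζ ≠ 1) :
    0 < ((1 - β - (ζ - β * conj ζ ^ m)) * (1 + m * conj β)).re := by
  set x := 1 - ζ with hx
  set X := ∑ k ∈ Finset.range m, (1 - ζ ^ k) - x with hX
  set d := x.re with hd
  set r := ‖β‖ with hr
  have hr0 : 0 ≤ r := norm_nonneg _
  have hm' : (2 : ℝ) ≤ m := by exact_mod_cast hm
  have hxne : x ≠ 0 := sub_ne_zero.2 hne.symm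
  have hxpos : 0 < ‖x‖ ^ 2 := by positivity
  have hxd : ‖x‖ ^ 2 ≤ 2 * d := by
    have h1 : ‖ζ‖ ^ 2 ≤ 1 := pow_le_one₀ (norm_nonneg _) hζ
    have hζx : ζ = 1 - x := by rw [hx]; ring
    rw [hζx, Complex.sq_norm, Complex.normSq_apply] at h1
    rw [Complex.sq_norm, Complex.normSq_apply]
    simp only [Complex.sub_re, Complex.sub_im, Complex.one_re, Complex.one_im] at h1
    nlinarith
  have hd0 : 0 < d := by linarith
  have hgeom : 1 - ζ ^ m = m * x - x ^ 2 - x * X := by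
    have := mul_neg_geom_sum ζ m
    rw [hX, Finset.sum_sub_distrib, Finset.sum_const, Finset.card_range, nsmul_eq_mul, mul_one]
    rw [← this]
    ring
  have hXle : ‖X‖ ≤ ((m : ℝ) * (m - 1) / 2 - 1) * ‖x‖ := norm_sum_one_sub_pow_sub_le hζ hm
  have hcoef : (0 : ℝ) ≤ m * (m - 1) / 2 - 1 := by nlinarith
  have hxX : ‖x * X‖ ≤ (m * (m - 1) - 2) * d := by
    rw [norm_mul]
    calc ‖x‖ * ‖X‖ ≤ ‖x‖ * (((m : ℝ) * (m - 1) / 2 - 1) * ‖x‖) := by gcongr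
      _ = ((m : ℝ) * (m - 1) / 2 - 1) * ‖x‖ ^ 2 := by ring
      _ ≤ ((m : ℝ) * (m - 1) / 2 - 1) * (2 * d) := by gcongr
      _ = _ := by ring
  have hpow : (1 - ζ ^ m).re ≤ m ^ 2 * d - 2 * d ^ 2 := by
    have h1 : (x ^ 2).re = 2 * d ^ 2 - ‖x‖ ^ 2 := by
      rw [Complex.sq_norm, Complex.normSq_apply, sq, Complex.mul_re]; ring
    have h2 : -(x * X).re ≤ ‖x * X‖ := (neg_le_abs _).trans (Complex.abs_re_le_norm _)
    rw [hgeom, Complex.sub_re, Complex.sub_re, ← Complex.ofReal_natCast, Complex.re_ofReal_mul, h1]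
    nlinarith
  have hmix : -(r * (m * (m - 1)) * d) ≤ (conj β * (x ^ 2 + x * X)).re := by
    have h1 : ‖conj β * (x ^ 2 + x * X)‖ ≤ r * (m * (m - 1) * d) := by
      rw [norm_mul, RCLike.norm_conj]
      gcongr
      refine (norm_add_le _ _).trans ?_
      rw [norm_pow]
      linarith
    have h2 := (neg_le_abs _).trans (Complex.abs_re_le_norm (conj β * (x ^ 2 + x * X)))
    linarith
  have hexp : ((1 - β - (ζ - β * conj ζ ^ m)) * (1 + m * conj β)).re =
      d - m * r ^ 2 * (1 - ζ ^ m).re + (conj β * (x ^ 2 + x * X)).re := by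
    have h1 : (1 - β - (ζ - β * conj ζ ^ m)) * (1 + m * conj β) =
        x + conj β * (m * x) - β * conj (1 - ζ ^ m) - ((m * r ^ 2 : ℝ) : ℂ) * conj (1 - ζ ^ m) := by
      have h2 : ((m * r ^ 2 : ℝ) : ℂ) = m * (β * conj β) := by
        rw [Complex.mul_conj, Complex.normSq_eq_norm_sq]; push_cast; rfl
      rw [h2, map_sub, map_one, map_pow, hx]
      ring
    have h3 : x ^ 2 + x * X = m * x - (1 - ζ ^ m) := by rw [hgeom]; ring
    have h4 : (β * conj (1 - ζ ^ m)).re = (conj β * (1 - ζ ^ m)).re := by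
      rw [← Complex.conj_re, map_mul, Complex.conj_conj]
    have h5 : (conj β * (m * x - (1 - ζ ^ m))).re =
        (conj β * (m * x)).re - (conj β * (1 - ζ ^ m)).re := by rw [mul_sub, Complex.sub_re]
    rw [h1, h3, Complex.sub_re, Complex.sub_re, Complex.add_re, Complex.re_ofReal_mul, h4,
      Complex.conj_re, h5]
    ring
  rw [hexp]
  have h1 : m * r ^ 2 * (1 - ζ ^ m).re ≤ m * r ^ 2 * (m ^ 2 * d - 2 * d ^ 2) := by gcongr
  have h2 : (m : ℝ) ^ 3 * r ^ 2 ≤ m * r := by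
    calc (m : ℝ) ^ 3 * r ^ 2 = (m * r) * (r * m ^ 2) := by ring
      _ ≤ m * r * 1 := by gcongr
      _ = _ := mul_one _
  have h3 : (m : ℝ) ^ 3 * r ^ 2 * d ≤ m * r * d := by gcongr
  have h4 : r * m ^ 2 * d ≤ 1 * d := by gcongr
  rcases hr0.eq_or_lt with h | h
  · rw [← h] at hmix ⊢
    simp only [zero_mul, neg_zero] at hmix
    nlinarith
  · have : 0 < m * r ^ 2 * (2 * d ^ 2) := by positivity
    nlinarith

variable {b : ℂ} {m : ℕ}

/-- The vector `e + m * (b * conj e ^ m)` is the tangent of the boundary curve at `e` divided by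
`i`, the outward normal. Rotating by `conj e` reduces to `e = 1`. -/
theorem supporting_line (hm : 2 ≤ m) (hb : ‖b‖ * m ^ 2 ≤ 1) {e z : ℂ} (he : ‖e‖ = 1)
    (hz : ‖z‖ ≤ 1) (hne : z ≠ e) :
    inner ℝ (e + m * (b * conj e ^ m)) (harmonicHypocycloid b m z - harmonicHypocycloid b m e) <
      0 := by
  have hee : e * conj e = 1 := by
    rw [Complex.mul_conj, Complex.normSq_eq_norm_sq, he]; simp
  have hne' : z * conj e ≠ 1 := fun h => hne <| by
    calc z = z * (e * conj e) := by rw [hee, mul_one]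
      _ = e * (z * conj e) := by ring
      _ = e := by rw [h, mul_one]
  have key := supporting_line_at_one (ζ := z * conj e) (β := b * conj e ^ (m + 1)) hm
    (by simpa [norm_mul, norm_pow, he] using hb) (by simpa [norm_mul, he] using hz) hne'
  rw [Complex.inner, ← neg_pos, ← Complex.neg_re]
  convert key using 2
  simp only [harmonicHypocycloid, map_add, map_mul, map_pow, Complex.conj_conj, map_natCast]
  have h1 : e ^ m * conj e ^ m = 1 := by rw [← mul_pow, hee, one_pow]
  generalize conj e = e' at *
  generalize conj z = z'
  generalize conj b = b'
  rw [pow_succ, pow_succ, mul_pow]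
  generalize e ^ m = p at *
  generalize e' ^ m = p' at *
  have hA : e * (1 - b * (p' * e') - (z * e' - b * (p' * e') * (z' ^ m * p))) =
      -((z - b * z' ^ m) - (e - b * p')) := by
    linear_combination (-(b * p') - z + b * z' ^ m * (p * p')) * hee + b * z' ^ m * h1
  have hB : e' * (1 + m * (b' * (p * e))) = e' + m * (b' * p) := by
    linear_combination m * b' * p * hee
  linear_combination -(e' * (1 + m * (b' * (p * e)))) * hA +
    ((z - b * z' ^ m) - (e - b * p')) * hB +
    (1 - b * (p' * e') - (z * e' - b * (p' * e') * (z' ^ m * p))) * (1 + m * (b' * (p * e))) * hee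

/-- As `‖b‖ * m ≤ 1 / m ≤ 1 / 2`, the map is a small Lipschitz perturbation of the identity;
injectivity and openness follow. -/
theorem norm_sub_sub_le (hm : 2 ≤ m) (hb : ‖b‖ * m ^ 2 ≤ 1) {z w : ℂ} (hz : ‖z‖ ≤ 1)
    (hw : ‖w‖ ≤ 1) :
    ‖harmonicHypocycloid b m z - harmonicHypocycloid b m w - (z - w)‖ ≤ 1 / 2 * ‖z - w‖ := by
  have e : harmonicHypocycloid b m z - harmonicHypocycloid b m w - (z - w) =
      -(b * (conj z ^ m - conj w ^ m)) := by
    simp only [harmonicHypocycloid]; ring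
  have h1 := Complex.norm_pow_sub_pow_le_mul (z := conj z) (w := conj w)
    (by rwa [RCLike.norm_conj]) (by rwa [RCLike.norm_conj]) m
  rw [← map_sub, RCLike.norm_conj] at h1
  rw [e, norm_neg, norm_mul]
  have hm' : (2 : ℝ) ≤ m := by exact_mod_cast hm
  have h2 : ‖b‖ * m ≤ 1 / 2 := by
    have : 0 ≤ ‖b‖ * m := by positivity
    nlinarith
  calc ‖b‖ * ‖conj z ^ m - conj w ^ m‖ ≤ ‖b‖ * (m * ‖z - w‖) := by gcongr
    _ = ‖b‖ * m * ‖z - w‖ := by ring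
    _ ≤ _ := by gcongr

theorem norm_sub_le (hm : 2 ≤ m) (hb : ‖b‖ * m ^ 2 ≤ 1) {z w : ℂ} (hz : ‖z‖ ≤ 1) (hw : ‖w‖ ≤ 1) :
    ‖z - w‖ ≤ 2 * ‖harmonicHypocycloid b m z - harmonicHypocycloid b m w‖ := by
  have h1 := norm_sub_sub_le hm hb hz hw
  have h2 := norm_sub_norm_le (z - w) (harmonicHypocycloid b m z - harmonicHypocycloid b m w)
  rw [norm_sub_rev (z - w)] at h2
  linarith

theorem isOpen_image_ball (hm : 2 ≤ m) (hb : ‖b‖ * m ^ 2 ≤ 1) :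
    IsOpen (harmonicHypocycloid b m '' Metric.ball 0 1) := by
  have h : ApproximatesLinearOn (harmonicHypocycloid b m)
      ((ContinuousLinearEquiv.refl ℝ ℂ : ℂ ≃L[ℝ] ℂ) : ℂ →L[ℝ] ℂ) (Metric.ball 0 1) (1 / 2) := by
    intro x hx y hy
    exact norm_sub_sub_le hm hb (mem_ball_zero_iff.1 hx).le (mem_ball_zero_iff.1 hy).le
  refine h.open_image (ContinuousLinearEquiv.refl ℝ ℂ).toNonlinearRightInverse Metric.isOpen_ball
    (Or.inr ?_)
  have hn : (ContinuousLinearEquiv.refl ℝ ℂ).toNonlinearRightInverse.nnnorm = 1 :=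
    nnnorm_one (G := ℂ →L[ℝ] ℂ)
  rw [hn, inv_one]
  exact NNReal.half_lt_self one_ne_zero

theorem continuous : Continuous (harmonicHypocycloid b m) := by
  unfold harmonicHypocycloid
  fun_prop

theorem apply_zero (hm : 2 ≤ m) : harmonicHypocycloid b m 0 = 0 := by
  simp [harmonicHypocycloid, show m ≠ 0 by lia]

theorem combo_mem_image_ball (hm : 2 ≤ m) (hb : ‖b‖ * m ^ 2 ≤ 1) {x y : ℂ}
    (hx : x ∈ harmonicHypocycloid b m '' Metric.closedBall 0 1)
    (hy : y ∈ harmonicHypocycloid b m '' Metric.closedBall 0 1) (hxy : x ≠ y) {s t : ℝ}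
    (hs : 0 < s) (ht : 0 < t) (hst : s + t = 1) :
    s • x + t • y ∈ harmonicHypocycloid b m '' Metric.ball 0 1 := by
  by_contra hp
  set p := s • x + t • y with hpdef
  set κ := harmonicHypocycloid b m
  -- By connectedness the segment from `0` to `p` meets the image of the unit circle. The supporting
  -- line there has `0` and `p` strictly on one side, yet passes through a point between them.
  have hexit : ∃ q ∈ segment ℝ 0 p, q ∈ κ '' Metric.closedBall 0 1 ∧ q ∉ κ '' Metric.ball 0 1 := by
    by_contra! hno
    by_cases hpK : p ∈ κ '' Metric.closedBall 0 1
    · exact hp (hno p (right_mem_segment ..) hpK)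
    · have hcl : IsClosed (κ '' Metric.closedBall 0 1) :=
        ((isCompact_closedBall 0 1).image continuous).isClosed
      obtain ⟨q, -, ⟨q', hq', rfl⟩, hq2⟩ := (convex_segment (𝕜 := ℝ) 0 p).isPreconnected
        (κ '' Metric.ball 0 1) (κ '' Metric.closedBall 0 1)ᶜ (isOpen_image_ball hm hb)
        hcl.isOpen_compl (fun q hq => or_iff_not_imp_right.2 fun h => hno q hq (not_not.1 h))
        ⟨0, left_mem_segment .., 0, by simp, apply_zero hm⟩ ⟨p, right_mem_segment .., hpK⟩
      exact hq2 ⟨q', Metric.ball_subset_closedBall hq', rfl⟩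
  obtain ⟨q, ⟨s', t', hs', ht', hst', hq⟩, ⟨e, he, rfl⟩, heU⟩ := hexit
  have he1 : ‖e‖ = 1 := by
    refine le_antisymm (mem_closedBall_zero_iff.1 he) (not_lt.1 fun h => ?_)
    exact heU ⟨e, mem_ball_zero_iff.2 h, rfl⟩
  set N := e + m * (b * conj e ^ m)
  have hle : ∀ v ∈ κ '' Metric.closedBall 0 1, v ≠ κ e → inner ℝ N (v - κ e) < 0 := by
    rintro _ ⟨z, hz, rfl⟩ hne
    exact supporting_line hm hb he1 (mem_closedBall_zero_iff.1 hz) fun h => hne (by rw [h])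
  have hle' : ∀ v ∈ κ '' Metric.closedBall 0 1, inner ℝ N (v - κ e) ≤ 0 := fun v hv => by
    by_cases h : v = κ e
    · rw [h, sub_self, inner_zero_right]
    · exact (hle v hv h).le
  have hp0 : inner ℝ N (p - κ e) < 0 := by
    have e1 : p - κ e = s • (x - κ e) + t • (y - κ e) := by
      have : κ e = (s + t) • κ e := by rw [hst, one_smul]
      rw [hpdef, smul_sub, smul_sub]
      nth_rw 1 [this]
      rw [add_smul]; abel
    rw [e1, inner_add_right, inner_smul_right, inner_smul_right]
    by_cases h : x = κ e
    · have h1 := hle y hy (fun h' => hxy (h.trans h'.symm))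
      have h2 := hle' x hx
      nlinarith
    · have h1 := hle x hx h
      have h2 := hle' y hy
      nlinarith
  have h0 : inner ℝ N (0 - κ e) < 0 := by
    refine hle 0 ⟨0, by simp, apply_zero hm⟩ fun h => heU ⟨0, by simp, (apply_zero hm).trans h⟩
  have hsum : s' * inner ℝ N (0 - κ e) + t' * inner ℝ N (p - κ e) = 0 := by
    have e1 : s' • (0 - κ e) + t' • (p - κ e) = 0 := by
      rw [smul_sub, smul_sub, sub_add_sub_comm, hq, ← add_smul, hst', one_smul, sub_self]
    rw [← real_inner_smul_right, ← real_inner_smul_right, ← inner_add_right, e1, inner_zero_right]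
  rcases hs'.eq_or_lt with h | h
  · have : t' = 1 := by linarith
    nlinarith
  · nlinarith

theorem convex_image_closedBall (hm : 2 ≤ m) (hb : ‖b‖ * m ^ 2 ≤ 1) :
    Convex ℝ (harmonicHypocycloid b m '' Metric.closedBall 0 1) := by
  rw [convex_iff_openSegment_subset]
  rintro x hx y hy p ⟨s, t, hs, ht, hst, rfl⟩
  by_cases hxy : x = y
  · rw [← hxy, ← add_smul, hst, one_smul]; exact hx
  · exact Set.image_mono Metric.ball_subset_closedBall
      (combo_mem_image_ball hm hb hx hy hxy hs ht hst)

end harmonicHypocycloid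

/-! ### Monotonicity in a convex coordinate -/

/-- If `κ` maps `C` onto a convex set whose open chords are in the open image of `D ⊆ C`, and the
derivatives of `F` and `κ` on `D` are positive relative to each other, then `F` is strictly monotone
in the coordinate `κ`. -/
theorem inner_sub_sub_pos_of_inner_fderiv_pos {E : Type*} [NormedAddCommGroup E]
    [InnerProductSpace ℝ E] [FiniteDimensional ℝ E] {C D : Set E} {F κ : E → E}
    {F' κ' : E → E →L[ℝ] E} {A : ℝ} (hDC : D ⊆ C) (hF : ContinuousOn F C)
    (hF' : ∀ z ∈ D, HasFDerivAt F (F' z) z) (hκ' : ∀ z ∈ D, HasFDerivAt κ (κ' z) z)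
    (hanti : ∀ z ∈ C, ∀ w ∈ C, ‖z - w‖ ≤ A * ‖κ z - κ w‖) (hopen : IsOpen (κ '' D))
    (hchord : ∀ x ∈ κ '' C, ∀ y ∈ κ '' C, x ≠ y → ∀ s t : ℝ, 0 < s → 0 < t → s + t = 1 →
      s • x + t • y ∈ κ '' D)
    (hpos : ∀ z ∈ D, ∀ v, v ≠ 0 → 0 < inner ℝ (F' z v) (κ' z v)) {z w : E} (hz : z ∈ C)
    (hw : w ∈ C) (hne : z ≠ w) :
    0 < inner ℝ (F z - F w) (κ z - κ w) := by
  have hinj : ∀ z ∈ C, ∀ w ∈ C, κ z = κ w → z = w := fun z hz w hw h => by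
    have := hanti z hz w hw
    rw [h, sub_self, norm_zero, mul_zero] at this
    exact sub_eq_zero.1 (norm_le_zero_iff.1 this)
  set σ := Function.invFunOn κ C with hσ
  have hσC : ∀ x ∈ κ '' C, σ x ∈ C := fun x hx => Function.invFunOn_mem hx
  have hκσ : ∀ x ∈ κ '' C, κ (σ x) = x := fun x hx => Function.invFunOn_eq hx
  have hσκ : ∀ z ∈ C, σ (κ z) = z := fun z hz =>
    hinj _ (hσC _ ⟨z, hz, rfl⟩) _ hz (hκσ _ ⟨z, hz, rfl⟩)
  have hUK : κ '' D ⊆ κ '' C := Set.image_mono hDC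
  have hσcont : ContinuousOn σ (κ '' C) := by
    refine LipschitzOnWith.continuousOn (K := A.toNNReal) (LipschitzOnWith.of_dist_le_mul ?_)
    intro x hx y hy
    have h := hanti _ (hσC x hx) _ (hσC y hy)
    rw [hκσ x hx, hκσ y hy] at h
    rw [dist_eq_norm, dist_eq_norm]
    refine h.trans ?_
    gcongr
    exact Real.le_coe_toNNReal A
  have hσ' : ∀ x ∈ κ '' D, ∃ σ' : E →L[ℝ] E, HasFDerivAt σ σ' x ∧ ∀ v, κ' (σ x) (σ' v) = v := by
    rintro _ ⟨z, hz, rfl⟩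
    -- A kernel vector of `κ'` would make the positive pairing vanish, so `κ'` is invertible and `κ`
    -- has a differentiable local inverse.
    have hker : LinearMap.ker (κ' z : E →ₗ[ℝ] E) = ⊥ := by
      rw [LinearMap.ker_eq_bot']
      intro v hv
      by_contra hv0
      have hv' : κ' z v = 0 := hv
      have := hpos z hz v hv0
      rw [hv', inner_zero_right] at this
      exact this.false
    let e : E ≃L[ℝ] E :=
      (LinearEquiv.ofInjectiveEndo (κ' z : E →ₗ[ℝ] E) (LinearMap.ker_eq_bot.1 hker)).toContinuousLinearEquiv
    have he : (e : E →L[ℝ] E) = κ' z := by ext v; rfl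
    have hnhds : κ '' D ∈ nhds (κ z) := hopen.mem_nhds ⟨z, hz, rfl⟩
    refine ⟨e.symm, HasFDerivAt.of_local_left_inverse (f := κ) (f' := e) ?_ ?_ ?_, fun v => ?_⟩
    · exact hσcont.continuousAt (Filter.mem_of_superset hnhds hUK)
    · rw [hσκ z (hDC hz), he]; exact hκ' z hz
    · filter_upwards [hnhds] with y hy using hκσ y (hUK hy)
    · rw [hσκ z (hDC hz), ← he]; exact e.apply_symm_apply v
  set d := κ z - κ w with hd
  have hd0 : κ w ≠ κ z := fun h => hne (hinj z hz w hw h.symm)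
  let γ : ℝ → E := fun t => κ w + t • d
  have hγU : ∀ t ∈ Set.Ioo (0 : ℝ) 1, γ t ∈ κ '' D := fun t ht => by
    have e : γ t = (1 - t) • κ w + t • κ z := by
      simp only [γ, hd, smul_sub, sub_smul, one_smul]; abel
    rw [e]
    exact hchord _ ⟨w, hw, rfl⟩ _ ⟨z, hz, rfl⟩ hd0 _ _ (sub_pos.2 ht.2) ht.1 (by ring)
  have hγ0 : γ 0 = κ w := by simp [γ]
  have hγ1 : γ 1 = κ z := by simp [γ, hd]
  have hγK : ∀ t ∈ Set.Icc (0 : ℝ) 1, γ t ∈ κ '' C := fun t ht => by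
    rcases ht.1.eq_or_lt with h | h
    · rw [← h, hγ0]; exact ⟨w, hw, rfl⟩
    rcases ht.2.eq_or_lt with h' | h'
    · rw [h', hγ1]; exact ⟨z, hz, rfl⟩
    exact hUK (hγU t ⟨h, h'⟩)
  -- The derivative along the chord is the pairing at `v = σ' d`, because `κ' v = d`.
  have hmono : StrictMonoOn (fun t => inner ℝ (F (σ (γ t))) d) (Set.Icc 0 1) := by
    refine strictMonoOn_of_deriv_pos (convex_Icc 0 1) ?_ fun t ht => ?_
    · refine ContinuousOn.inner ?_ continuousOn_const
      refine hF.comp (hσcont.comp (by fun_prop) hγK) fun t ht => hσC _ (hγK t ht)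
    · rw [interior_Icc] at ht
      obtain ⟨σ', h1, h2⟩ := hσ' _ (hγU t ht)
      obtain ⟨y, hy, hyγ⟩ := hγU t ht
      have hσD : σ (γ t) ∈ D := by rw [← hyγ, hσκ y (hDC hy)]; exact hy
      have hγd : HasDerivAt γ d t := by
        have := ((hasDerivAt_id t).smul_const d).const_add (κ w)
        rwa [one_smul] at this
      have h3 := ((hF' _ hσD).comp_hasDerivAt t (h1.comp_hasDerivAt t hγd)).inner ℝ
        (hasDerivAt_const t d)
      have h4 : 0 < inner ℝ (F' (σ (γ t)) (σ' d)) d := by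
        have := hpos _ hσD (σ' d) fun h => by
          have := h2 d
          rw [h, map_zero] at this
          exact hd0 (sub_eq_zero.1 this.symm).symm
        rwa [h2 d] at this
      have h5 := h3.deriv
      simp only [inner_zero_right, zero_add] at h5
      exact h4.trans_eq h5.symm
  have h := hmono (Set.left_mem_Icc.2 zero_le_one) (Set.right_mem_Icc.2 zero_le_one) zero_lt_one
  simp only [hγ0, hγ1, hσκ z hz, hσκ w hw] at h
  rw [inner_sub_left]
  linarith

/-! ### Close-to-convexity of the image -/

/-- Let `κ` parametrize a compact convex set by the closed disk and let `F` be strictly monotone in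
the coordinate `κ`. The rays from the boundary values of `F` along the outward normals of the convex
set show that the image of the open disk is close-to-convex. -/
theorem isCloseToConvexSet_image_of_monotone {F κ : ℂ → ℂ} {A B : ℝ} (hA : 0 ≤ A)
    (hF : ∀ z w, ‖F z - F w‖ ≤ A * ‖z - w‖) (hκ : Continuous κ)
    (hanti : ∀ z ∈ Metric.closedBall (0 : ℂ) 1, ∀ w ∈ Metric.closedBall (0 : ℂ) 1,
      ‖z - w‖ ≤ B * ‖κ z - κ w‖)
    (hopen : IsOpen (κ '' Metric.ball 0 1)) (hconv : Convex ℝ (κ '' Metric.closedBall 0 1))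
    (hsupp : ∀ e : ℂ, ‖e‖ = 1 → ∃ u : ℂ, ‖u‖ = 1 ∧
      ∀ w ∈ Metric.closedBall (0 : ℂ) 1, inner ℝ u (κ w - κ e) ≤ 0)
    (hmono : ∀ z ∈ Metric.closedBall (0 : ℂ) 1, ∀ w ∈ Metric.closedBall (0 : ℂ) 1, z ≠ w →
      0 < inner ℝ (F z - F w) (κ z - κ w)) :
    IsCloseToConvexSet (F '' Metric.ball 0 1) := by
  have hsub : ∀ z : ℂ, ‖z‖ < 1 → z ∈ Metric.closedBall (0 : ℂ) 1 := fun z hz =>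
    mem_closedBall_zero_iff.2 hz.le
  have hsph : ∀ z : ℂ, ‖z‖ = 1 → z ∈ Metric.closedBall (0 : ℂ) 1 := fun z hz =>
    mem_closedBall_zero_iff.2 hz.le
  have hdisj : ∀ z ∈ Metric.closedBall (0 : ℂ) 1, ∀ w ∈ Metric.closedBall (0 : ℂ) 1, ∀ u v : ℂ,
      ∀ s t : ℝ, 0 ≤ s → 0 ≤ t → inner ℝ u (κ w - κ z) ≤ 0 → inner ℝ v (κ z - κ w) ≤ 0 →
      F z + s * u = F w + t * v → z = w := by
    intro z hz w hw u v s t hs ht hu hv h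
    -- If the rays met, `F z - F w` would be `t • v - s • u`, whose inner product with `κ z - κ w`
    -- is at most `0` by normality.
    by_contra hne
    have h1 := hmono z hz w hw hne
    have e1 : F z - F w = t • v - s • u := by
      rw [Complex.real_smul, Complex.real_smul]; linear_combination h
    rw [e1, inner_sub_left, real_inner_smul_left, real_inner_smul_left,
      ← neg_sub (κ w) (κ z), inner_neg_right (x := u), neg_sub] at h1
    nlinarith
  refine ⟨{r | ∃ z : ℂ, ‖z‖ = 1 ∧ r.1 = F z ∧ ‖r.2‖ = 1 ∧
    ∀ w ∈ Metric.closedBall (0 : ℂ) 1, inner ℝ r.2 (κ w - κ z) ≤ 0}, ?_, ?_, ?_⟩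
  · rintro r ⟨z, -, -, h, -⟩
    exact h
  · refine Set.Subset.antisymm (fun y hy => ?_) (Set.iUnion₂_subset ?_)
    · set σ := Function.invFunOn κ (Metric.closedBall (0 : ℂ) 1) with hσ
      have hσC : ∀ x ∈ κ '' Metric.closedBall 0 1, σ x ∈ Metric.closedBall (0 : ℂ) 1 := fun x hx =>
        Function.invFunOn_mem hx
      have hκσ : ∀ x ∈ κ '' Metric.closedBall 0 1, κ (σ x) = x := fun x hx =>
        Function.invFunOn_eq hx
      obtain ⟨x, hx, hvi⟩ := exists_variational_inequality_of_monotone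
        (P := fun x => F (σ x) - y) (L := A * B) (K := κ '' Metric.closedBall 0 1)
        ⟨κ 0, 0, by simp, rfl⟩ ((isCompact_closedBall 0 1).image hκ) hconv
        (fun x hx x' hx' => by
          rw [sub_sub_sub_cancel_right, mul_assoc]
          refine (hF _ _).trans (mul_le_mul_of_nonneg_left ?_ hA)
          have := hanti _ (hσC x hx) _ (hσC x' hx')
          rwa [hκσ x hx, hκσ x' hx'] at this)
        (fun x hx x' hx' => by
          rw [sub_sub_sub_cancel_right]
          by_cases h : σ x = σ x'
          · rw [h, sub_self, inner_zero_left]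
          · have := hmono _ (hσC x hx) _ (hσC x' hx') h
            rw [hκσ x hx, hκσ x' hx'] at this
            exact this.le)
      set z := σ x with hz
      have hzC := hσC x hx
      have hvi' : ∀ w ∈ Metric.closedBall (0 : ℂ) 1, inner ℝ (y - F z) (κ w - κ z) ≤ 0 := by
        intro w hw
        have := hvi (κ w) ⟨w, hw, rfl⟩
        rw [← hκσ x hx] at this
        rw [← neg_sub, inner_neg_left]
        simpa [hz] using this
      -- At an interior point of the convex set only `0` is normal, which would give `y = F z`, a
      -- point of the image.
      have hznorm : ‖z‖ = 1 := by
        refine le_antisymm (mem_closedBall_zero_iff.1 hzC) (not_lt.1 fun hlt => hy ?_)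
        have hnhds : κ '' Metric.ball 0 1 ∈ nhds (κ z + (0 : ℝ) • (y - F z)) := by
          rw [zero_smul, add_zero]
          exact hopen.mem_nhds ⟨z, mem_ball_zero_iff.2 hlt, rfl⟩
        have hcont : ContinuousAt (fun t : ℝ => κ z + t • (y - F z)) 0 := by fun_prop
        obtain ⟨t, ⟨w, hw, hwt⟩, ht⟩ := Filter.nonempty_of_mem (Filter.inter_mem
          (nhdsWithin_le_nhds (hcont hnhds)) (self_mem_nhdsWithin (s := Set.Ioi (0 : ℝ))))
        have h1 := hvi' w (Metric.ball_subset_closedBall hw)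
        have ht' : 0 < t := ht
        have hwt' : κ w = κ z + t • (y - F z) := hwt
        rw [hwt', add_sub_cancel_left, real_inner_smul_right, real_inner_self_eq_norm_sq] at h1
        have h2 : ‖y - F z‖ = 0 := by
          by_contra h
          have : 0 < ‖y - F z‖ := lt_of_le_of_ne (norm_nonneg _) (Ne.symm h)
          have : 0 < t * ‖y - F z‖ ^ 2 := by positivity
          linarith
        exact ⟨z, mem_ball_zero_iff.2 hlt, (sub_eq_zero.1 (norm_eq_zero.1 h2)).symm⟩
      by_cases hyz : y = F z
      · obtain ⟨u, hu1, hu⟩ := hsupp z hznorm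
        exact Set.mem_iUnion₂.2 ⟨(F z, u), ⟨z, hznorm, rfl, hu1, hu⟩, 0, le_rfl, by simp [hyz]⟩
      · have hpos : 0 < ‖y - F z‖ := norm_pos_iff.2 (sub_ne_zero.2 hyz)
        refine Set.mem_iUnion₂.2 ⟨(F z, (‖y - F z‖⁻¹ : ℝ) • (y - F z)), ⟨z, hznorm, rfl, ?_, ?_⟩,
          ‖y - F z‖, hpos.le, ?_⟩
        · rw [norm_smul, norm_inv, norm_norm, inv_mul_cancel₀ hpos.ne']
        · intro w hw
          rw [real_inner_smul_left]
          exact mul_nonpos_of_nonneg_of_nonpos (by positivity) (hvi' w hw)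
        · rw [← Complex.real_smul, smul_smul, mul_inv_cancel₀ hpos.ne', one_smul]
          ring
    · rintro ⟨p, u⟩ ⟨z, hz, hp, -, hu⟩ y ⟨t, ht, hy⟩ ⟨w, hw, hwy⟩
      simp only at hp hu hy
      -- An image point counts as a degenerate ray with direction `0`.
      have h := hdisj z (hsph z hz) w (Metric.ball_subset_closedBall hw) u 0 t 0 ht le_rfl
        (hu w (Metric.ball_subset_closedBall hw)) (by simp) (by rw [← hp, ← hy, hwy]; simp)
      rw [mem_ball_zero_iff, ← h, hz] at hw
      exact hw.false
  · rintro ⟨p, u⟩ ⟨z, hz, hp, hu1, hu⟩ ⟨q, v⟩ ⟨w, hw, hq, hv1, hv⟩ hne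
    simp only at hp hu hu1 hq hv hv1
    refine Set.disjoint_left.2 ?_
    rintro y ⟨s, hs, hys⟩ ⟨t, ht, hyt⟩
    simp only at hys hyt
    have h := hdisj z (hsph z hz) w (hsph w hw) u v s t hs.le ht.le (hu w (hsph w hw))
      (hv z (hsph z hz)) (by rw [← hp, ← hq, ← hys, ← hyt])
    subst h
    have hpq : p = q := hp.trans hq.symm
    have hst : (s : ℂ) * u = t * v := by
      rw [hys, hpq] at hyt
      exact add_left_cancel hyt
    have hst' : s = t := by
      have := congrArg norm hst
      rwa [norm_mul, norm_mul, hu1, hv1, mul_one, mul_one, Complex.norm_real, Complex.norm_real,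
        Real.norm_eq_abs, Real.norm_eq_abs, abs_of_pos hs, abs_of_pos ht] at this
    subst hst'
    have huv : u = v := mul_left_cancel₀ (Complex.ofReal_ne_zero.2 hs.ne') hst
    exact hne (by rw [hpq, huv])

/-! ### Differentials of harmonic maps -/

/-- The real-linear map `v ↦ a * v + conj (b * v)`. -/
noncomputable def wirtingerCLM (a b : ℂ) : ℂ →L[ℝ] ℂ :=
  a • (1 : ℂ →L[ℝ] ℂ) + (Complex.conjCLE : ℂ →L[ℝ] ℂ).comp (b • (1 : ℂ →L[ℝ] ℂ))

theorem wirtingerCLM_apply (a b v : ℂ) : wirtingerCLM a b v = a * v + conj (b * v) := by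
  simp [wirtingerCLM]

theorem det_wirtingerCLM (a b : ℂ) : (wirtingerCLM a b).det = ‖a‖ ^ 2 - ‖b‖ ^ 2 := by
  rw [ContinuousLinearMap.det, ← LinearMap.det_toMatrix Complex.basisOneI, Matrix.det_fin_two]
  simp [LinearMap.toMatrix_apply, wirtingerCLM_apply, Complex.sq_norm, Complex.normSq_apply]
  ring

theorem HasDerivAt.hasFDerivAt_add_conj {h g : ℂ → ℂ} {a b z : ℂ} (hh : HasDerivAt h a z)
    (hg : HasDerivAt g b z) :
    HasFDerivAt (fun z => h z + conj (g z)) (wirtingerCLM a b) z :=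
  hh.complexToReal_fderiv.add
    ((Complex.conjCLE : ℂ →L[ℝ] ℂ).hasFDerivAt.comp z hg.complexToReal_fderiv)

/-- Pairing of the differentials of two harmonic maps with derivative `p`, `1` of their analytic
parts and opposite dilatations `ω`, `-ω`. -/
theorem inner_wirtingerCLM_of_opposite_dilatation (p ω v : ℂ) :
    inner ℝ (wirtingerCLM p (ω * p) v) (wirtingerCLM 1 (-ω) v) =
      p.re * (1 - ‖ω‖ ^ 2) * ‖v‖ ^ 2 := by
  simp only [wirtingerCLM_apply, Complex.inner, Complex.sq_norm, Complex.normSq_apply]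
  simp
  ring

theorem AnalyticOnNhd.harmonicOnNhd_add_conj {h g : ℂ → ℂ} {s : Set ℂ} (hh : AnalyticOnNhd ℂ h s)
    (hg : AnalyticOnNhd ℂ g s) :
    InnerProductSpace.HarmonicOnNhd (fun z => h z + conj (g z)) s := fun z hz =>
  (hh z hz).harmonicAt.add (hg z hz).harmonicAt_conj

theorem IsClassG.re_deriv_pos {h : ℂ → ℂ} (hh : IsClassG h) {z : ℂ} (hz : ‖z‖ < 1) :
    0 < (deriv h z).re := by
  have h1 := (Complex.re_le_norm _).trans_lt (hh.norm_deriv_sub_one_lt hz)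
  rw [Complex.sub_re, Complex.one_re] at h1
  linarith

theorem IsClassG.norm_deriv_le {h : ℂ → ℂ} (hh : IsClassG h) {z : ℂ} (hz : ‖z‖ < 1) :
    ‖deriv h z‖ ≤ 2 := by
  have h1 := hh.norm_deriv_sub_one_lt hz
  have h2 := norm_sub_le (1 : ℂ) (1 - deriv h z)
  rw [sub_sub_cancel, norm_one] at h2
  linarith

/-! ### The main theorem -/

theorem mainTheorem9 (h g : ℂ → ℂ) (n : ℕ) (c : ℂ)
    (hh : IsClassG h)
    (hg : AnalyticOnNhd ℂ g (Metric.ball 0 1))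
    (hn : 1 ≤ n)
    (hc_pos : 0 < ‖c‖)
    (hc_le : ‖c‖ ≤ 1 / ((n : ℝ) + 1))
    (hgh : ∀ z ∈ Metric.ball (0 : ℂ) 1, deriv g z = c * z ^ n * deriv h z) :
    IsCloseToConvexHarmonic (fun z => h z + conj (g z)) ∧
      IsUnivalent (fun z => h z + conj (g z)) := by
  set f : ℂ → ℂ := fun z => h z + conj (g z) with hf
  have hn' : (1 : ℝ) ≤ n := by exact_mod_cast hn
  have hc1 : ‖c‖ < 1 := hc_le.trans_lt (by rw [div_lt_one (by positivity)]; linarith)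
  have hω : ∀ z : ℂ, ‖z‖ < 1 → ‖c * z ^ n‖ < 1 := fun z hz => by
    rw [norm_mul, norm_pow]
    exact (mul_le_of_le_one_right (norm_nonneg _) (pow_le_one₀ (norm_nonneg _) hz.le)).trans_lt hc1
  have hhd : ∀ z : ℂ, ‖z‖ < 1 → HasDerivAt h (deriv h z) z := fun z hz =>
    (hh.analytic z (mem_ball_zero_iff.2 hz)).differentiableAt.hasDerivAt
  have hgd : ∀ z : ℂ, ‖z‖ < 1 → HasDerivAt g (c * z ^ n * deriv h z) z := fun z hz => by
    rw [← hgh z (mem_ball_zero_iff.2 hz)]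
    exact (hg z (mem_ball_zero_iff.2 hz)).differentiableAt.hasDerivAt
  have hfd : ∀ z : ℂ, ‖z‖ < 1 →
      HasFDerivAt f (wirtingerCLM (deriv h z) (c * z ^ n * deriv h z)) z := fun z hz =>
    (hhd z hz).hasFDerivAt_add_conj (hgd z hz)
  have hjac : ∀ z ∈ Metric.ball (0 : ℂ) 1, 0 < (fderiv ℝ f z).det := fun z hz => by
    have hz' := mem_ball_zero_iff.1 hz
    rw [(hfd z hz').fderiv, det_wirtingerCLM, norm_mul (c * z ^ n)]
    have h1 : 0 < ‖deriv h z‖ := norm_pos_iff.2 (hh.deriv_ne_zero z hz)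
    have h2 : ‖c * z ^ n‖ * ‖deriv h z‖ < ‖deriv h z‖ := mul_lt_of_lt_one_left h1 (hω z hz')
    have h3 : 0 ≤ ‖c * z ^ n‖ * ‖deriv h z‖ := by positivity
    nlinarith
  have hlip : ∀ φ : ℂ → ℂ, (∀ z : ℂ, ‖z‖ < 1 → DifferentiableAt ℂ φ z ∧ ‖deriv φ z‖ ≤ 2) →
      ∀ z ∈ Metric.ball (0 : ℂ) 1, ∀ w ∈ Metric.ball (0 : ℂ) 1, ‖φ z - φ w‖ ≤ 2 * ‖z - w‖ :=
    fun φ hφ z hz w hw => Convex.norm_image_sub_le_of_norm_deriv_le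
      (fun x hx => (hφ x (mem_ball_zero_iff.1 hx)).1) (fun x hx => (hφ x (mem_ball_zero_iff.1 hx)).2)
      (convex_ball 0 1) hw hz
  have hhlip := hlip h fun z hz => ⟨(hhd z hz).differentiableAt, hh.norm_deriv_le hz⟩
  have hglip := hlip g fun z hz => ⟨(hgd z hz).differentiableAt, by
    rw [(hgd z hz).deriv, norm_mul]
    exact (mul_le_of_le_one_left (norm_nonneg _) (hω z hz).le).trans (hh.norm_deriv_le hz)⟩
  have hflip : LipschitzOnWith 4 f (Metric.ball 0 1) := LipschitzOnWith.of_dist_le_mul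
    fun z hz w hw => by
      rw [dist_eq_norm, dist_eq_norm]
      have e : f z - f w = (h z - h w) + conj (g z - g w) := by
        simp only [hf, map_sub]; ring
      rw [e]
      refine (norm_add_le _ _).trans ?_
      rw [RCLike.norm_conj, NNReal.coe_ofNat]
      linarith [hhlip z hz w hw, hglip z hz w hw]
  -- The Lipschitz extension supplies the boundary values of `f`.
  obtain ⟨F, hFlip, hFf⟩ := hflip.extend_finite_dimension
  set m := n + 1 with hm
  -- Chosen so that `κ` has dilatation `-(c * z ^ n)`; then `‖b‖ * m ^ 2 = ‖c‖ * (n + 1)`, and the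
  -- hypothesis on `c` is exactly the convexity bound.
  set b : ℂ := conj c / (m : ℂ) with hb
  have hm2 : 2 ≤ m := by lia
  have hm0 : (m : ℂ) ≠ 0 := by exact_mod_cast (show m ≠ 0 by lia)
  have hb1 : ‖b‖ * m ^ 2 ≤ 1 := by
    rw [hb, norm_div, RCLike.norm_conj, Complex.norm_natCast, hm]
    push_cast
    rw [le_div_iff₀ (by positivity)] at hc_le
    calc ‖c‖ / ((n : ℝ) + 1) * ((n : ℝ) + 1) ^ 2 = ‖c‖ * (n + 1) := by field_simp
      _ ≤ 1 := hc_le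
  set κ := harmonicHypocycloid b m with hκ
  have hκd : ∀ z : ℂ, HasFDerivAt κ (wirtingerCLM 1 (-(c * z ^ n))) z := fun z => by
    have h1 : HasDerivAt (fun z : ℂ => -(conj b) * z ^ m) (-(c * z ^ n)) z := by
      convert! (hasDerivAt_pow m z).const_mul (-(conj b)) using 1
      rw [hb, hm, map_div₀, Complex.conj_conj, map_natCast, Nat.add_sub_cancel]
      rw [hm] at hm0
      field_simp
    convert (hasDerivAt_id z).hasFDerivAt_add_conj h1 using 1
    ext w
    simp [hκ, harmonicHypocycloid, sub_eq_add_neg]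
  have hFd : ∀ z ∈ Metric.ball (0 : ℂ) 1,
      HasFDerivAt F (wirtingerCLM (deriv h z) (c * z ^ n * deriv h z)) z := fun z hz =>
    (hfd z (mem_ball_zero_iff.1 hz)).congr_of_eventuallyEq
      (Filter.eventually_of_mem (Metric.isOpen_ball.mem_nhds hz) fun w hw => (hFf hw).symm)
  have hanti : ∀ z ∈ Metric.closedBall (0 : ℂ) 1, ∀ w ∈ Metric.closedBall (0 : ℂ) 1,
      ‖z - w‖ ≤ 2 * ‖κ z - κ w‖ := fun z hz w hw =>
    harmonicHypocycloid.norm_sub_le hm2 hb1 (mem_closedBall_zero_iff.1 hz)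
      (mem_closedBall_zero_iff.1 hw)
  have hopen := harmonicHypocycloid.isOpen_image_ball hm2 hb1
  have hmono : ∀ z ∈ Metric.closedBall (0 : ℂ) 1, ∀ w ∈ Metric.closedBall (0 : ℂ) 1, z ≠ w →
      0 < inner ℝ (F z - F w) (κ z - κ w) := fun z hz w hw hne =>
    inner_sub_sub_pos_of_inner_fderiv_pos Metric.ball_subset_closedBall
      hFlip.continuous.continuousOn hFd (fun z _ => hκd z) hanti hopen
      (fun x hx y hy hxy s t => harmonicHypocycloid.combo_mem_image_ball hm2 hb1 hx hy hxy)
      (fun z hz v hv => by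
        have hz' := mem_ball_zero_iff.1 hz
        rw [inner_wirtingerCLM_of_opposite_dilatation]
        have h1 := hh.re_deriv_pos hz'
        have h2 : 0 < 1 - ‖c * z ^ n‖ ^ 2 := by
          have := pow_lt_one₀ (norm_nonneg _) (hω z hz') two_ne_zero
          linarith
        have h3 : 0 < ‖v‖ := norm_pos_iff.2 hv
        positivity) hz hw hne
  have huniv : IsUnivalent f := fun z hz w hw hzw => by
    by_contra hne
    have h1 := hmono z (Metric.ball_subset_closedBall hz) w (Metric.ball_subset_closedBall hw) hne
    rw [← hFf hz, ← hFf hw, hzw, sub_self, inner_zero_left] at h1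
    exact h1.false
  have hrange : IsCloseToConvexSet (f '' Metric.ball 0 1) := by
    rw [hFf.image_eq]
    refine isCloseToConvexSet_image_of_monotone (NNReal.coe_nonneg _)
      (fun z w => by simpa only [dist_eq_norm] using hFlip.dist_le_mul z w)
      harmonicHypocycloid.continuous hanti hopen
      (harmonicHypocycloid.convex_image_closedBall hm2 hb1) (fun e he => ?_) hmono
    set N := e + m * (b * conj e ^ m) with hN
    have hle : ∀ w ∈ Metric.closedBall (0 : ℂ) 1, w ≠ e → inner ℝ N (κ w - κ e) < 0 :=
      fun w hw hne =>
        harmonicHypocycloid.supporting_line hm2 hb1 he (mem_closedBall_zero_iff.1 hw) hne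
    have hN0 : 0 < ‖N‖ := by
      refine norm_pos_iff.2 fun h0 => ?_
      have h1 := hle 0 (by simp) (fun h => by rw [← h, norm_zero] at he; exact zero_ne_one he)
      rw [h0, inner_zero_left] at h1
      exact h1.false
    refine ⟨(‖N‖⁻¹ : ℝ) • N, ?_, fun w hw => ?_⟩
    · rw [norm_smul, norm_inv, norm_norm, inv_mul_cancel₀ hN0.ne']
    · rw [real_inner_smul_left]
      by_cases hwe : w = e
      · simp [hwe]
      · exact mul_nonpos_of_nonneg_of_nonpos (by positivity) (hle w hw hwe).le
  exact ⟨⟨⟨hh.analytic.harmonicOnNhd_add_conj hg, hjac⟩, huniv, hrange⟩, huniv⟩
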